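/- Let $\mathcal X$ be a Borel subset of $\mathbb R^d$, let $\lambda$ be Lebesgue measure on $\mathcal X$, and let $P_0$ be a probability measure on $\mathcal X$ with Lebesgue density $\eta_0 = dP_0/d\lambda$. Let $X_1, X_2, \dots$ be IID from $P_0$ (the coordinates of the product space $(\mathcal X,\mathcal B,P_0)^\infty$), let $\mathbb P_n$ be the empirical distribution of $X_1,\dots,X_n$, write $Pf=\int f\,dP$, and $\mathbb G_n f = n^{1/2}(\mathbb P_n-P_0)f$. Let $P_0^*$ denote outer probability and $E_0^*$ outer expectation. Events $A_n$ that need not be measurable are said to hold with probability tending to one if $P_0^*(A_n^c)\to 0$, and $Y_n = o_{P_0^*}(n^{-r})$ means $P_0^*(|Y_n|\ge \varepsilon n^{-r})\to 0$ for every $\varepsilon>0$. A class $\mathcal F$ of measurable, $P_0$-integrable functions $\mathcal X\to\mathbb R$ is $P_0$-Donsker if for every $n$ almost every sample path of $f\mapsto\mathbb G_n f$ is bounded on $\mathcal F$ and $\mathbb G_n$ converges weakly in $\ell^\infty(\mathcal F)$ to a tight, Borel measurable limit $\mathbb G_0$, that is, $E_0^*h(\mathbb G_n)\to E\,h(\mathbb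 G_0)$ for every bounded continuous $h:\ell^\infty(\mathcal F)\to\mathbb R$. For each $n$ let $\eta_n:\mathcal X\to\mathbb R$ be a function determined by $X_1,\dots,X_n$ (an estimator of $\eta_0$). Let $\psi_0=\int\eta_0^2\,d\lambda$ and $\phi_0 = 2(\eta_0-\psi_0)$, and define the one-step, plug-in and empirical-mean plug-in estimators $$\psi_{n,1}=2\,\mathbb P_n\eta_n-\int\eta_n^2\,d\lambda,\qquad \psi_{n,2}=\int\eta_n^2\,d\lambda,\qquad \psi_{n,3}=\mathbb P_n\eta_n .$$ An estimator $\psi_n$ of $\psi_0$ is asymptotically linear with influence function $\phi_0$ if $P_0\phi_0=0$, $P_0\phi_0^2<\infty$ and $\psi_n=\psi_0+\mathbb P_n\phi_0+o_{P_0^*}(n^{-1/2})$. Suppose that there is a $P_0$-Donsker class $\mathcal F$ such that $\eta_n\in\mathcal F$ with probability tending to one, that there is $M\in(0,\infty)$ such that $\|\eta_0\|_\infty<M$ and, with probability tending to one, $\|\eta_n\|_\infty<M$ (essential suprema with respect to $\lambda$), and that $\|\eta_n-\eta_0\|_{L_2(\lambda)}=o_{P_0^*}(n^{-1/4})$. Then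 $\psi_{n,1}$ is asymptotically linear with influence function $\phi_0$. If in addition $\int\eta_n^2\,d\lambda-\mathbb P_n\eta_n=o_{P_0^*}(n^{-1/2})$, then $\psi_{n,2}$ and $\psi_{n,3}$ are asymptotically linear with influence function $\phi_0$ as well. -/

import Mathlib

open MeasureTheory ProbabilityTheory Filter Topology
open scoped ENNReal BoundedContinuousFunction

noncomputable section

namespace AvgDensity

/-! ### Outer expectation and weak convergence of possibly non-measurable maps -/

section Outer

variable {Ω : Type*} [MeasurableSpace Ω]

/-- The outer expectation `E* T` of a bounded, possibly non-measurable function `T` on a probability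
space: the infimum of `E U` over the measurable integrable majorants `U` of `T`. -/
def outerExpectation (μ : Measure Ω) (T : Ω → ℝ) : ℝ :=
  sInf {c : ℝ | ∃ U : Ω → ℝ, Measurable U ∧ Integrable U μ ∧ (∀ᵐ ω ∂μ, T ω ≤ U ω) ∧
    c = ∫ ω, U ω ∂μ}

/-- Weak convergence, in a metric space `D`, of the possibly non-measurable maps `G n : Ω → D`
to a Borel law `ν`: `E* h(G n) → ∫ h dν` for all bounded continuous `h : D → ℝ`. -/
def WeaklyConverges {D : Type*} [MetricSpace D] [MeasurableSpace D] [BorelSpace D]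
    (μ : Measure Ω) (G : ℕ → Ω → D) (ν : Measure D) : Prop :=
  ∀ h : D →ᵇ ℝ,
    Tendsto (fun n => outerExpectation μ (fun ω => h (G n ω))) atTop (𝓝 (∫ z, h z ∂ν))

/-- The events `A n` hold with probability tending to one. Events need not be measurable, so this
says that the outer probability of the complement tends to zero (a measure applied to an
arbitrary set is its outer probability). -/
def WithProbTendingToOne (μ : Measure Ω) (A : ℕ → Set Ω) : Prop :=
  Tendsto (fun n => μ (A n)ᶜ) atTop (𝓝 0)

/-- `Y n = o(n ^ (-r))` in outer probability, for `Y n` with values in `[0, ∞]`. -/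
def IsLittleOP (μ : Measure Ω) (r : ℝ) (Y : ℕ → Ω → ℝ≥0∞) : Prop :=
  ∀ ε : ℝ, 0 < ε →
    Tendsto (fun n : ℕ => μ {ω | ENNReal.ofReal (ε * (n : ℝ) ^ (-r)) ≤ Y n ω}) atTop (𝓝 0)

end Outer

/-! ### The bounded functions on a class, and its Borel sets -/

/-- `ℓ^∞(F)`: the bounded real functions on `F` with the supremum norm. -/
abbrev EllInfty {α : Type*} (F : Set α) : Type _ := lp (fun _ : F => ℝ) ∞

instance EllInfty.instMeasurableSpace {α : Type*} (F : Set α) : MeasurableSpace (EllInfty F) :=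
  borel _

instance EllInfty.instBorelSpace {α : Type*} (F : Set α) : BorelSpace (EllInfty F) := ⟨rfl⟩

/-! ### IID samples, empirical processes and Donsker classes -/

section Empirical

variable {X : Type*} [MeasurableSpace X]

/-- The law of an IID sequence from `P`, on the space of all sequences; the observations
are the coordinates. -/
abbrev iidLaw (P : Measure X) [IsProbabilityMeasure P] : Measure (ℕ → X) :=
  Measure.infinitePi (fun _ : ℕ => P)

/-- The first `n` observations. -/
def sample (n : ℕ) (ω : ℕ → X) : Fin n → X := fun i => ω i

/-- `ℙₙ f`, the average of `f` over the sample. -/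
def empMean {n : ℕ} (x : Fin n → X) (f : X → ℝ) : ℝ := (∑ i, f (x i)) / n

/-- `𝔾ₙ f = √n (ℙₙ - P) f`. -/
def empG (P : Measure X) (n : ℕ) (ω : ℕ → X) (f : X → ℝ) : ℝ :=
  √(n : ℝ) * (empMean (sample n ω) f - ∫ x, f x ∂P)

open Classical in
/-- `𝔾ₙ` as a map into `ℓ^∞(F)`; it is set to `0` at the points where its sample path is
unbounded (a null set for the classes `F` considered below). -/
def empGMap (P : Measure X) (F : Set (X → ℝ)) (n : ℕ) (ω : ℕ → X) : EllInfty F :=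
  if h : Memℓp (fun f : F => empG P n ω f) ∞ then ⟨fun f : F => empG P n ω f, h⟩ else 0

/-- `F` is a `P`-Donsker class: a class of measurable, `P`-integrable functions for which almost
all sample paths of `𝔾ₙ` are bounded on `F`, and `𝔾ₙ` converges weakly in `ℓ^∞(F)` to a tight
Borel probability law. -/
structure IsDonsker (P : Measure X) [IsProbabilityMeasure P] (F : Set (X → ℝ)) : Prop where
  measurable : ∀ f ∈ F, Measurable f
  integrable : ∀ f ∈ F, Integrable f P
  bounded : ∀ n : ℕ, ∀ᵐ ω ∂(iidLaw P), ∃ C : ℝ, ∀ f ∈ F, |empG P n ω f| ≤ C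
  weaklyConverges : ∃ ν : Measure (EllInfty F), IsProbabilityMeasure ν ∧
    IsTightMeasureSet {ν} ∧ WeaklyConverges (iidLaw P) (empGMap P F) ν

/-- A sequence of estimators `T n` (the value at sample size `n` being a function of the
first `n` observations) is asymptotically linear for the real number `ψ` with influence function
`φ`: `φ` has `P`-mean zero and finite `P`-variance, and `T n = ψ + ℙₙ φ + o(n^(-1/2))` in outer
probability. -/
structure IsAsymptoticallyLinear (P : Measure X) [IsProbabilityMeasure P]
    (T : ∀ n : ℕ, (Fin n → X) → ℝ) (ψ : ℝ) (φ : X → ℝ) : Prop where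
  memLp : MemLp φ 2 P
  mean_zero : ∫ x, φ x ∂P = 0
  remainder : IsLittleOP (iidLaw P) (1 / 2)
    (fun n ω => ‖T n (sample n ω) - ψ - empMean (sample n ω) φ‖ₑ)

end Empirical

/-! ### The average density value and its estimators -/

section Density

/-- Lebesgue measure on a subset `S` of `ℝᵈ`, as a measure on the type of points of `S`. -/
def lebesgueOn {d : ℕ} (S : Set (EuclideanSpace ℝ (Fin d))) : Measure S :=
  (volume : Measure (EuclideanSpace ℝ (Fin d))).comap Subtype.val

variable {X : Type*} [MeasurableSpace X]

/-- `η` is (a version of) the density of `P` with respect to `lam`. -/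
structure IsDensityOf (lam : Measure X) (η : X → ℝ) (P : Measure X) : Prop where
  measurable : Measurable η
  nonneg : ∀ᵐ x ∂lam, 0 ≤ η x
  eq_withDensity : P = lam.withDensity (fun x => ENNReal.ofReal (η x))

/-- The average density value `∫ η²`. -/
def avgDensity (lam : Measure X) (η : X → ℝ) : ℝ := ∫ x, η x ^ 2 ∂lam

/-- The influence function `x ↦ 2 (η x - ∫ η²)`. -/
def influence (lam : Measure X) (η : X → ℝ) : X → ℝ := fun x => 2 * (η x - avgDensity lam η)

/-- The one-step estimator `2 ℙₙ ηₙ - ∫ ηₙ²` built from a nuisance estimator `η`, which maps the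
first `n` observations to a real function `η n x` on the sample space. -/
def oneStep (lam : Measure X) (η : ∀ n : ℕ, (Fin n → X) → X → ℝ) (n : ℕ) (x : Fin n → X) : ℝ :=
  2 * empMean x (η n x) - avgDensity lam (η n x)

/-- The plug-in estimator `∫ ηₙ²`. -/
def plugIn (lam : Measure X) (η : ∀ n : ℕ, (Fin n → X) → X → ℝ) (n : ℕ) (x : Fin n → X) : ℝ :=
  avgDensity lam (η n x)

/-- The empirical mean plug-in estimator `ℙₙ ηₙ`. -/
def meanPlugIn (η : ∀ n : ℕ, (Fin n → X) → X → ℝ) (n : ℕ) (x : Fin n → X) : ℝ :=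
  empMean x (η n x)

end Density

end AvgDensity

end

/-! Because `η₀` is the density of `P`, the map `η ↦ ∫ η²` has an exact quadratic expansion, and the
one-step remainder equals `2 (ℙₙ - P)(ηₙ - η₀) - ∫ (ηₙ - η₀)² dλ` (`sqrt_mul_oneStep_remainder`).
The squared `n^(-1/4)` rate makes the second term `o(n^(-1/2))`. The first term is an empirical
process at a random function. The bound on `η₀` gives `P ≤ M λ`, hence consistency in `L²(P)`, and
asymptotic equicontinuity over the Donsker class makes it negligible
(`IsDonsker.tendsto_measure_le_abs_empG_sub`).

Equicontinuity is extracted from weak convergence to a tight law alone, with no appeal to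
Gaussianity or to the paths of the limit. Finitely many small balls of positive limit mass capture
nearly all of `𝔾ₙ`. If `f` and `g` are close in `L²(P)`, Chebyshev makes `𝔾ₙ f - 𝔾ₙ g` small with
probability so near one that no ball centre can separate `f` from `g` by much; so neither can any
path of `𝔾ₙ` close to one of the centres.

The other two estimators differ from the one-step estimator by `2` and `1` times `∫ ηₙ² - ℙₙ ηₙ`. -/

namespace AvgDensity

/-! ### Outer expectations and portmanteau bounds -/

section Outer

variable {Ω : Type*} [MeasurableSpace Ω] {μ : Measure Ω} [IsProbabilityMeasure μ]

/-- Markov's inequality for outer expectations. -/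
theorem measure_one_le_of_outerExpectation_lt {T : Ω → ℝ} (h0 : ∀ ω, 0 ≤ T ω) (h1 : ∀ ω, T ω ≤ 1)
    {c : ℝ} (hc : outerExpectation μ T < c) : μ {ω | 1 ≤ T ω} ≤ ENNReal.ofReal c := by
  obtain ⟨_, ⟨U, hU, hUi, hTU, rfl⟩, hlt⟩ := exists_lt_of_csInf_lt
    (s := {c : ℝ | ∃ U : Ω → ℝ, Measurable U ∧ Integrable U μ ∧ (∀ᵐ ω ∂μ, T ω ≤ U ω) ∧
      c = ∫ ω, U ω ∂μ})
    ⟨_, fun _ => 1, measurable_const, integrable_const _, ae_of_all _ h1, rfl⟩ hc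
  have hU0 : 0 ≤ᵐ[μ] U := hTU.mono fun ω hω => (h0 ω).trans hω
  have hle : μ {ω | 1 ≤ T ω} ≤ μ {ω | 1 ≤ U ω} :=
    measure_mono_ae (hTU.mono fun ω hω (h : 1 ≤ T ω) => (h.trans hω : 1 ≤ U ω))
  have hmarkov := mul_meas_ge_le_integral_of_nonneg hU0 hUi 1
  rw [one_mul] at hmarkov
  refine hle.trans ?_
  rw [← ofReal_measureReal]
  exact ENNReal.ofReal_le_ofReal (hmarkov.trans hlt.le)

/-- The indicator of `B` is an admissible majorant. Nonnegativity of `T` bounds the competing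
integrals below, which the real-valued `sInf` requires. -/
theorem outerExpectation_le_measureReal {T : Ω → ℝ} (h0 : ∀ ω, 0 ≤ T ω) {B : Set Ω}
    (hB : MeasurableSet B) (hT : ∀ᵐ ω ∂μ, T ω ≤ B.indicator (fun _ => (1 : ℝ)) ω) :
    outerExpectation μ T ≤ μ.real B := by
  refine csInf_le ⟨0, ?_⟩ ⟨B.indicator fun _ => 1, measurable_const.indicator hB,
    (integrable_const _).indicator hB, hT, ?_⟩
  · rintro _ ⟨U, -, -, hTU, rfl⟩
    exact integral_nonneg_of_ae (hTU.mono fun ω hω => (h0 ω).trans hω)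
  · simp [integral_indicator_const _ hB]

variable {D : Type*} [MetricSpace D]

/-- The thickened indicator as a bounded continuous real function. -/
noncomputable def realThickenedIndicator {δ : ℝ} (hδ : 0 < δ) (A : Set D) : D →ᵇ ℝ :=
  BoundedContinuousFunction.ofNormedAddCommGroup (fun z => (thickenedIndicator hδ A z : ℝ))
    (by fun_prop) 1 fun z => by
      simpa using thickenedIndicator_le_one hδ A z

theorem realThickenedIndicator_apply {δ : ℝ} (hδ : 0 < δ) (A : Set D) (z : D) :
    realThickenedIndicator hδ A z = thickenedIndicator hδ A z := rfl

variable [MeasurableSpace D] [BorelSpace D] {G : ℕ → Ω → D} {ν : Measure D} [IsProbabilityMeasure ν]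

theorem measureReal_le_integral_realThickenedIndicator {δ : ℝ} (hδ : 0 < δ) {A : Set D}
    (hA : MeasurableSet A) : ν.real A ≤ ∫ z, realThickenedIndicator hδ A z ∂ν := by
  have : ν.real A = ∫ z, A.indicator (fun _ => (1 : ℝ)) z ∂ν := by
    simp [integral_indicator_const _ hA]
  rw [this]
  refine integral_mono ((integrable_const _).indicator hA)
    (BoundedContinuousFunction.integrable _ _) fun z => ?_
  by_cases hz : z ∈ A
  · simp [hz, realThickenedIndicator_apply, thickenedIndicator_one hδ A hz]
  · simp [hz, realThickenedIndicator_apply]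

/-- Upper portmanteau bound for outer probabilities. -/
theorem WeaklyConverges.eventually_measure_notMem_thickening_le (h : WeaklyConverges μ G ν)
    {δ : ℝ} (hδ : 0 < δ) {A : Set D} (hA : MeasurableSet A) {c : ℝ} (hc : 1 - ν.real A < c) :
    ∀ᶠ n in atTop, μ {ω | G n ω ∉ Metric.thickening δ A} ≤ ENNReal.ofReal c := by
  -- This test function is `1` off the thickening, so Markov applies to it, and it vanishes on `A`.
  have hlim := h (1 - realThickenedIndicator hδ A)
  have hint : ∫ z, (1 - realThickenedIndicator hδ A) z ∂ν < c := by
    simp only [BoundedContinuousFunction.coe_sub, Pi.sub_apply, BoundedContinuousFunction.coe_one,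
      Pi.one_apply]
    rw [integral_sub (integrable_const _) (BoundedContinuousFunction.integrable _ _)]
    have := measureReal_le_integral_realThickenedIndicator (ν := ν) hδ hA
    simp only [integral_const, probReal_univ, smul_eq_mul, mul_one]
    linarith
  filter_upwards [hlim.eventually_lt_const hint] with n hn
  refine (measure_mono ?_).trans (measure_one_le_of_outerExpectation_lt ?_ ?_ hn)
  · intro ω hω
    have h0 := thickenedIndicator_zero hδ A hω
    simp only [Set.mem_ofPred_eq, BoundedContinuousFunction.coe_sub, Pi.sub_apply,
      BoundedContinuousFunction.coe_one, Pi.one_apply, realThickenedIndicator_apply, h0]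
    simp
  · intro ω
    simpa [realThickenedIndicator_apply] using thickenedIndicator_le_one hδ A (G n ω)
  · intro ω
    simp [realThickenedIndicator_apply]

/-- Lower portmanteau bound for outer probabilities. -/
theorem WeaklyConverges.eventually_lt_measureReal (h : WeaklyConverges μ G ν)
    {δ : ℝ} (hδ : 0 < δ) {A : Set D} (hA : MeasurableSet A) {c : ℝ} (hc : c < ν.real A) :
    ∀ᶠ n in atTop, ∀ B : Set Ω, MeasurableSet B →
      (∀ᵐ ω ∂μ, G n ω ∈ Metric.thickening δ A → ω ∈ B) → c < μ.real B := by
  filter_upwards [(h (realThickenedIndicator hδ A)).eventually_const_lt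
    (hc.trans_le (measureReal_le_integral_realThickenedIndicator hδ hA))] with n hn B hB hGB
  refine hn.trans_le (outerExpectation_le_measureReal (fun ω => ?_) hB ?_)
  · simp [realThickenedIndicator_apply]
  · filter_upwards [hGB] with ω hω
    by_cases hmem : G n ω ∈ Metric.thickening δ A
    · simpa [hω hmem, realThickenedIndicator_apply] using thickenedIndicator_le_one hδ A (G n ω)
    · simpa [realThickenedIndicator_apply, thickenedIndicator_zero hδ A hmem] using
        Set.indicator_nonneg (fun _ _ => zero_le_one) ω

end Outer

/-- A tight law charges finitely many balls of radius `δ` with positive mass each and total mass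
close to one. -/
theorem exists_finset_iUnion_ball {D : Type*} [MetricSpace D] [MeasurableSpace D] [BorelSpace D]
    {ν : Measure D} [IsProbabilityMeasure ν] (hν : IsTightMeasureSet {ν}) {δ ε : ℝ} (hδ : 0 < δ)
    (hε : 0 < ε) : ∃ t : Finset D, (∀ z ∈ t, 0 < ν.real (Metric.ball z δ)) ∧
      1 - ν.real (⋃ z ∈ t, Metric.ball z δ) < ε := by
  classical
  obtain ⟨K, hK, hνK⟩ := isTightMeasureSet_iff_exists_isCompact_measure_compl_le.1 hν
    (ENNReal.ofReal (ε / 2)) (by simpa using hε)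
  obtain ⟨s, -, hs, hKs⟩ := hK.finite_cover_balls hδ
  refine ⟨hs.toFinset.filter fun z => 0 < ν.real (Metric.ball z δ), fun z hz =>
    (Finset.mem_filter.1 hz).2, ?_⟩
  set t := hs.toFinset.filter fun z => 0 < ν.real (Metric.ball z δ) with ht
  have hmeas : MeasurableSet (⋃ z ∈ t, Metric.ball z δ) :=
    Finset.measurableSet_biUnion _ fun z _ => measurableSet_ball
  have hnull : ν (⋃ z ∈ s \ t, Metric.ball z δ) = 0 := by
    refine (measure_biUnion_null_iff (hs.subset Set.sdiff_subset).countable).2 fun z hz => ?_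
    -- The balls dropped from the cover are exactly the null ones, so dropping them loses no mass.
    have : ¬ 0 < ν.real (Metric.ball z δ) := fun h => hz.2 (by simp [ht, hz.1, h])
    exact (measureReal_eq_zero_iff).1 (le_antisymm (not_lt.1 this) measureReal_nonneg)
  have hsub : (⋃ z ∈ t, Metric.ball z δ)ᶜ ⊆ Kᶜ ∪ ⋃ z ∈ s \ t, Metric.ball z δ := by
    intro x hx
    by_cases hxK : x ∈ K
    · obtain ⟨z, hz, hxz⟩ := Set.mem_iUnion₂.1 (hKs hxK)
      refine Or.inr (Set.mem_iUnion₂.2 ⟨z, ⟨hz, fun hzt => hx ?_⟩, hxz⟩)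
      exact Set.mem_iUnion₂.2 ⟨z, hzt, hxz⟩
    · exact Or.inl hxK
  have hle : ν (⋃ z ∈ t, Metric.ball z δ)ᶜ ≤ ENNReal.ofReal (ε / 2) := by
    refine (measure_mono hsub).trans ((measure_union_le _ _).trans ?_)
    rw [hnull, add_zero]
    exact hνK ν rfl
  rw [← probReal_compl_eq_one_sub hmeas]
  exact (ENNReal.toReal_le_of_le_ofReal (by positivity) hle).trans_lt (by linarith)

theorem abs_apply_sub_le_dist {α : Type*} {F : Set α} (z w : EllInfty F) (f : F) :
    |z f - w f| ≤ dist z w := by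
  rw [dist_eq_norm]
  simpa using lp.norm_apply_le_norm (by simp) (z - w) f

/-! ### Chebyshev's inequality and asymptotic equicontinuity -/

section Empirical

variable {X : Type*} [MeasurableSpace X] {P : Measure X}

theorem integral_sq_le_of_eLpNorm_lt {u : X → ℝ} (hu : AEStronglyMeasurable u P) {τ : ℝ}
    (h : eLpNorm u 2 P < ENNReal.ofReal τ) : ∫ x, u x ^ 2 ∂P ≤ τ ^ 2 := by
  have hτ : 0 < τ := by
    by_contra hτ
    simp [ENNReal.ofReal_of_nonpos (not_lt.1 hτ)] at h
  have hmem : MemLp u 2 P := ⟨hu, h.trans ENNReal.ofReal_lt_top⟩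
  rw [hmem.eLpNorm_eq_integral_rpow_norm (by simp) (by simp),
    ENNReal.ofReal_lt_ofReal_iff hτ] at h
  have h0 : 0 ≤ ∫ x, u x ^ 2 ∂P := integral_nonneg fun x => sq_nonneg _
  have h' : √(∫ x, u x ^ 2 ∂P) < τ := by
    simpa [Real.sqrt_eq_rpow] using h
  exact (Real.sqrt_le_left hτ.le).1 h'.le

theorem empG_sub {f g : X → ℝ} (hf : Integrable f P) (hg : Integrable g P) (n : ℕ) (ω : ℕ → X) :
    empG P n ω (fun x => f x - g x) = empG P n ω f - empG P n ω g := by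
  simp only [empG, empMean, Finset.sum_sub_distrib, integral_sub hf hg]
  ring

theorem measurable_empG {u : X → ℝ} (hu : Measurable u) (n : ℕ) :
    Measurable fun ω => empG P n ω u := by
  unfold empG empMean sample
  fun_prop

theorem empGMap_apply {F : Set (X → ℝ)} {n : ℕ} {ω : ℕ → X}
    (h : ∃ C : ℝ, ∀ f ∈ F, |empG P n ω f| ≤ C) (f : F) :
    empGMap P F n ω f = empG P n ω f := by
  obtain ⟨C, hC⟩ := h
  have hmem : Memℓp (fun f : F => empG P n ω f) ∞ :=
    memℓp_infty ⟨C, by rintro _ ⟨f, rfl⟩; exact hC f f.2⟩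
  rw [empGMap, dif_pos hmem]

variable [IsProbabilityMeasure P]

/-- Chebyshev's inequality for the empirical process. -/
theorem measureReal_le_abs_empG_le {u : X → ℝ} (hu : Measurable u) (hu2 : MemLp u 2 P) (n : ℕ)
    {t : ℝ} (ht : 0 < t) :
    (iidLaw P).real {ω | t ≤ |empG P n ω u|} ≤ (∫ x, u x ^ 2 ∂P) / t ^ 2 := by
  have h0 : 0 ≤ (∫ x, u x ^ 2 ∂P) / t ^ 2 :=
    div_nonneg (integral_nonneg fun x => sq_nonneg _) (sq_nonneg t)
  -- At `n = 0` the factor `√n` makes `empG` vanish.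
  rcases Nat.eq_zero_or_pos n with rfl | hn
  · simpa [empG, not_le.2 ht] using h0
  have hn' : (0 : ℝ) < n := by exact_mod_cast hn
  have hmp : ∀ i : Fin n, MeasurePreserving (fun ω : ℕ → X => ω i) (iidLaw P) P := fun i =>
    measurePreserving_eval_infinitePi (fun _ : ℕ => P) (i : ℕ)
  have hmem : ∀ i : Fin n, MemLp (fun ω : ℕ → X => u (ω i)) 2 (iidLaw P) := fun i =>
    hu2.comp_measurePreserving (hmp i)
  let Y : (ℕ → X) → ℝ := fun ω => (√(n : ℝ) / n) * ∑ i : Fin n, u (ω i)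
  have hY : MemLp Y 2 (iidLaw P) := (memLp_finsetSum _ fun i _ => hmem i).const_mul _
  have hint : ∀ i : Fin n, ∫ ω, u (ω i) ∂(iidLaw P) = ∫ x, u x ∂P := fun i => by
    have h := integral_map (μ := iidLaw P) (hmp i).measurable.aemeasurable (f := u)
      hu.aestronglyMeasurable
    rw [(hmp i).map_eq] at h
    exact h.symm
  have hEY : ∫ ω, Y ω ∂(iidLaw P) = √(n : ℝ) * ∫ x, u x ∂P := by
    simp only [Y]
    rw [integral_const_mul, integral_finsetSum _ fun i _ => (hmem i).integrable (by simp)]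
    simp only [hint, Finset.sum_const, Finset.card_univ, Fintype.card_fin, nsmul_eq_mul]
    field_simp
  have hvar : Var[Y; iidLaw P] = Var[u; P] := by
    have hind : Set.Pairwise (↑(Finset.univ : Finset (Fin n)))
        fun i j : Fin n =>
          IndepFun (fun ω : ℕ → X => u (ω i)) (fun ω : ℕ → X => u (ω j)) (iidLaw P) := by
      intro i _ j _ hij
      exact (iIndepFun_infinitePi (P := fun _ : ℕ => P) (X := fun _ => u) fun _ => hu).indepFun
        (fun h => hij (Fin.ext h))
    have hsum := IndepFun.variance_sum (fun i _ => hmem i) hind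
    have hv : ∀ i : Fin n, Var[fun ω : ℕ → X => u (ω i); iidLaw P] = Var[u; P] := fun i =>
      (hmp i).variance_fun_comp hu.aemeasurable
    simp only [hv, Finset.sum_const, Finset.card_univ, Fintype.card_fin, nsmul_eq_mul] at hsum
    have hY' : Y = fun ω => (√(n : ℝ) / n) * (∑ i : Fin n, fun ω : ℕ → X => u (ω i)) ω := by
      ext ω; simp [Y]
    rw [hY', variance_const_mul, hsum, div_pow, Real.sq_sqrt hn'.le]
    field_simp
  have hG : ∀ ω, empG P n ω u = Y ω - ∫ ω, Y ω ∂(iidLaw P) := fun ω => by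
    rw [hEY]
    simp only [empG, empMean, sample, Y]
    ring
  have hcheb := meas_ge_le_variance_div_sq hY ht
  simp only [← hG, hvar] at hcheb
  refine ENNReal.toReal_le_of_le_ofReal h0 (hcheb.trans (ENNReal.ofReal_le_ofReal ?_))
  gcongr
  exact variance_le_expectation_sq hu.aestronglyMeasurable

/-- The empirical process over a Donsker class is asymptotically equicontinuous in the `L²(P)`
seminorm. -/
theorem IsDonsker.asymptotic_equicontinuity {F : Set (X → ℝ)} (hF : IsDonsker P F) {δ ε : ℝ}
    (hδ : 0 < δ) (hε : 0 < ε) : ∃ τ : ℝ, 0 < τ ∧ ∀ᶠ n in atTop,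
      iidLaw P {ω | ∃ f ∈ F, ∃ g ∈ F, eLpNorm (fun x => f x - g x) 2 P < ENNReal.ofReal τ ∧
        δ ≤ |empG P n ω f - empG P n ω g|} ≤ ENNReal.ofReal ε := by
  obtain ⟨ν, hνp, hνt, hw⟩ := hF.weaklyConverges
  -- Budget: a path within `2r` of a centre whose values at `f` and `g` differ by less than `5r` has
  -- increment below `2r + 5r + 2r < 10r`.
  obtain ⟨r, hr, rfl⟩ : ∃ r : ℝ, 0 < r ∧ 10 * r = δ := ⟨δ / 10, by positivity, by ring⟩
  obtain ⟨t, htpos, htε⟩ := exists_finset_iUnion_ball hνt hr hε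
  -- `τ² / r²` is the Chebyshev bound for an increment of size `r`; it is put below the mass of
  -- every ball.
  obtain ⟨τ, hτball, hτ⟩ : ∃ τ : ℝ, (∀ z ∈ t, τ ^ 2 / r ^ 2 < ν.real (Metric.ball z r)) ∧ 0 < τ := by
    refine (((Finset.eventually_all t).2 fun z hz => ?_).and
      (self_mem_nhdsWithin : Set.Ioi (0 : ℝ) ∈ 𝓝[>] 0)).exists
    have hlim : Tendsto (fun τ : ℝ => τ ^ 2 / r ^ 2) (𝓝[>] 0) (𝓝 0) := by
      have : Tendsto (fun τ : ℝ => τ ^ 2 / r ^ 2) (𝓝 0) (𝓝 (0 ^ 2 / r ^ 2)) :=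
        Continuous.tendsto (by fun_prop) 0
      simpa using this.mono_left nhdsWithin_le_nhds
    exact hlim.eventually_lt_const (htpos z hz)
  refine ⟨τ, hτ, ?_⟩
  have hmeas : MeasurableSet (⋃ z ∈ t, Metric.ball z r) :=
    Finset.measurableSet_biUnion _ fun z _ => measurableSet_ball
  filter_upwards [hw.eventually_measure_notMem_thickening_le hr hmeas htε,
    (Finset.eventually_all t).2 fun z hz =>
      hw.eventually_lt_measureReal hr measurableSet_ball (hτball z hz)] with n hup hlow
  have hz : ∀ z ∈ t, ∀ f g : F, eLpNorm (fun x => f.1 x - g.1 x) 2 P < ENNReal.ofReal τ →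
      |z f - z g| < 5 * r := by
    intro z hzt f g hfg
    have hm : Measurable fun x => f.1 x - g.1 x := (hF.measurable f f.2).sub (hF.measurable g g.2)
    have hmem : MemLp (fun x => f.1 x - g.1 x) 2 P :=
      ⟨hm.aestronglyMeasurable, hfg.trans ENNReal.ofReal_lt_top⟩
    have hcheb : (iidLaw P).real {ω | r ≤ |empG P n ω (fun x => f.1 x - g.1 x)|} ≤
        τ ^ 2 / r ^ 2 := by
      refine (measureReal_le_abs_empG_le hm hmem n hr).trans ?_
      gcongr
      exact integral_sq_le_of_eLpNorm_lt hm.aestronglyMeasurable hfg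
    by_contra hcon
    -- If the centre separated `f` and `g` by `5r`, every path within `2r` of it would have
    -- increment at least `r`. That event would exceed its Chebyshev bound, since the ball has mass
    -- above `τ² / r²`.
    refine (hlow z hzt {ω | r ≤ |empG P n ω (fun x => f.1 x - g.1 x)|}
      (measurableSet_le measurable_const (measurable_empG hm n).abs) ?_).not_ge hcheb
    filter_upwards [hF.bounded n] with ω hω hthick
    obtain ⟨y, hy, hdy⟩ := Metric.mem_thickening_iff.1 hthick
    have hdist : dist (empGMap P F n ω) z < 2 * r := by
      linarith [dist_triangle (empGMap P F n ω) y z, Metric.mem_ball.1 hy]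
    have h1 := (abs_apply_sub_le_dist (empGMap P F n ω) z f).trans_lt hdist
    have h2 := (abs_apply_sub_le_dist (empGMap P F n ω) z g).trans_lt hdist
    rw [empGMap_apply hω] at h1 h2
    change r ≤ |empG P n ω (fun x => f.1 x - g.1 x)|
    rw [empG_sub (hF.integrable f f.2) (hF.integrable g g.2)]
    by_contra hlt
    apply hcon
    rw [not_le] at hlt
    rw [abs_lt] at *
    constructor <;> linarith [h1.1, h1.2, h2.1, h2.2, hlt.1, hlt.2]
  -- Where the path is unbounded, `empGMap` takes its default value `0` and says nothing about
  -- `empG`; these points are removed.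
  have hnull : iidLaw P {ω | ¬ ∃ C : ℝ, ∀ f ∈ F, |empG P n ω f| ≤ C} = 0 :=
    ae_iff.1 (hF.bounded n)
  refine (measure_mono (t := {ω | empGMap P F n ω ∉ Metric.thickening r (⋃ z ∈ t, Metric.ball z r)}
    ∪ {ω | ¬ ∃ C : ℝ, ∀ f ∈ F, |empG P n ω f| ≤ C}) ?_).trans
    ((measure_union_le _ _).trans (by rwa [hnull, add_zero]))
  rintro ω ⟨f, hf, g, hg, hfg, hle⟩
  by_contra hcon
  simp only [Set.mem_union, Set.mem_ofPred_eq, not_or, not_not] at hcon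
  obtain ⟨hthick, hω⟩ := hcon
  obtain ⟨y, hy, hdy⟩ := Metric.mem_thickening_iff.1 hthick
  obtain ⟨z, hzt, hyz⟩ := Set.mem_iUnion₂.1 hy
  have hdist : dist (empGMap P F n ω) z < 2 * r := by
    linarith [dist_triangle (empGMap P F n ω) y z, Metric.mem_ball.1 hyz]
  have h1 := (abs_apply_sub_le_dist (empGMap P F n ω) z ⟨f, hf⟩).trans_lt hdist
  have h2 := (abs_apply_sub_le_dist (empGMap P F n ω) z ⟨g, hg⟩).trans_lt hdist
  have h3 := hz z hzt ⟨f, hf⟩ ⟨g, hg⟩ hfg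
  rw [empGMap_apply hω] at h1 h2
  refine hle.not_gt ?_
  rw [abs_lt] at *
  constructor <;> linarith [h1.1, h1.2, h2.1, h2.2, h3.1, h3.2]

end Empirical

end AvgDensity
namespace AvgDensity

/-! ### Stochastic orders in outer probability -/

section Outer

variable {Ω : Type*} [MeasurableSpace Ω] {μ : Measure Ω}

theorem tendsto_measure_zero_of_eventually_subset_union {S A B : ℕ → Set Ω}
    (hA : Tendsto (fun n => μ (A n)) atTop (𝓝 0)) (hB : Tendsto (fun n => μ (B n)) atTop (𝓝 0))
    (h : ∀ᶠ n in atTop, S n ⊆ A n ∪ B n) : Tendsto (fun n => μ (S n)) atTop (𝓝 0) := by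
  have hAB := hA.add hB
  rw [add_zero] at hAB
  exact tendsto_of_tendsto_of_tendsto_of_le_of_le' tendsto_const_nhds hAB
    (Eventually.of_forall fun _ => zero_le) (h.mono fun n hn =>
      (measure_mono hn).trans (measure_union_le _ _))

theorem WithProbTendingToOne.inter {A B : ℕ → Set Ω} (hA : WithProbTendingToOne μ A)
    (hB : WithProbTendingToOne μ B) : WithProbTendingToOne μ fun n => A n ∩ B n :=
  tendsto_measure_zero_of_eventually_subset_union hA hB
    (Eventually.of_forall fun _ => (Set.compl_inter _ _).subset)

theorem WithProbTendingToOne.exists_nonempty [IsProbabilityMeasure μ] {A : ℕ → Set Ω}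
    (hA : WithProbTendingToOne μ A) : ∃ n, (A n).Nonempty := by
  obtain ⟨n, hn⟩ := (Tendsto.eventually_lt_const zero_lt_one hA).exists
  refine ⟨n, Set.nonempty_iff_ne_empty.2 fun h => ?_⟩
  simp [h] at hn

theorem IsLittleOP.const_mul {r : ℝ} {Y : ℕ → Ω → ℝ≥0∞} (hY : IsLittleOP μ r Y) {c : ℝ}
    (hc : 0 < c) : IsLittleOP μ r fun n ω => ENNReal.ofReal c * Y n ω := by
  intro ε hε
  refine tendsto_measure_zero_of_eventually_subset_union (hY (ε / c) (by positivity))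
    (B := fun _ => ∅) (by simp) (Eventually.of_forall fun n ω hω => Or.inl ?_)
  have h : ENNReal.ofReal (ε * (n : ℝ) ^ (-r)) =
      ENNReal.ofReal c * ENNReal.ofReal (ε / c * (n : ℝ) ^ (-r)) := by
    rw [← ENNReal.ofReal_mul hc.le]
    congr 1
    field_simp
  simp only [Set.mem_ofPred_eq, h] at hω
  exact (ENNReal.mul_le_mul_iff_right (by simpa using hc) ENNReal.ofReal_ne_top).1 hω

theorem IsLittleOP.add {r : ℝ} {Y Z : ℕ → Ω → ℝ≥0∞} (hY : IsLittleOP μ r Y)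
    (hZ : IsLittleOP μ r Z) : IsLittleOP μ r fun n ω => Y n ω + Z n ω := by
  intro ε hε
  refine tendsto_measure_zero_of_eventually_subset_union (hY (ε / 2) (by positivity))
    (hZ (ε / 2) (by positivity)) (Eventually.of_forall fun n ω hω => ?_)
  by_contra hcon
  simp only [Set.mem_union, Set.mem_ofPred_eq, not_or, not_le] at hcon hω
  have h : ENNReal.ofReal (ε * (n : ℝ) ^ (-r)) =
      ENNReal.ofReal (ε / 2 * (n : ℝ) ^ (-r)) + ENNReal.ofReal (ε / 2 * (n : ℝ) ^ (-r)) := by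
    rw [← ENNReal.ofReal_add (by positivity) (by positivity)]
    congr 1
    ring
  exact (ENNReal.add_lt_add hcon.1 hcon.2).not_ge (h ▸ hω)

theorem IsLittleOP.mono {r : ℝ} {Y Z : ℕ → Ω → ℝ≥0∞} (hZ : IsLittleOP μ r Z)
    (h : ∀ n ω, Y n ω ≤ Z n ω) : IsLittleOP μ r Y := fun ε hε =>
  tendsto_measure_zero_of_eventually_subset_union (hZ ε hε) (B := fun _ => ∅) (by simp)
    (Eventually.of_forall fun n ω (hω : _ ≤ _) => Or.inl (hω.trans (h n ω)))

end Outer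

/-! ### Empirical processes at a random function -/

section Empirical

variable {X : Type*} [MeasurableSpace X] {P : Measure X} [IsProbabilityMeasure P]

/-- Empirical processes evaluated at a consistent random element of a Donsker class: the limit
`f₀` need not belong to the class. -/
theorem IsDonsker.tendsto_measure_le_abs_empG_sub {F : Set (X → ℝ)} (hF : IsDonsker P F)
    {f₀ : X → ℝ} (hf₀ : Measurable f₀) (hf₀2 : MemLp f₀ 2 P) {f : ℕ → (ℕ → X) → X → ℝ}
    (hfF : WithProbTendingToOne (iidLaw P) fun n => {ω | f n ω ∈ F})
    (hf : ∀ τ : ℝ, 0 < τ → WithProbTendingToOne (iidLaw P)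
      fun n => {ω | eLpNorm (fun x => f n ω x - f₀ x) 2 P < ENNReal.ofReal τ})
    {δ : ℝ} (hδ : 0 < δ) :
    Tendsto (fun n => iidLaw P {ω | δ ≤ |empG P n ω (f n ω) - empG P n ω f₀|}) atTop (𝓝 0) := by
  refine ENNReal.tendsto_nhds_zero.2 fun ε' hε' => ?_
  obtain ⟨ε, hε0, hε⟩ := ENNReal.lt_iff_exists_nnreal_btwn.1 hε'
  have hε0' : (0 : ℝ) < ε := by exact_mod_cast hε0
  obtain ⟨τ, hτ, hequi⟩ := hF.asymptotic_equicontinuity (half_pos hδ) (ε := ε / 3) (by positivity)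
  obtain ⟨ρ, ⟨hρτ, hρε⟩, hρ⟩ : ∃ ρ : ℝ, (ρ < τ / 2 ∧ ρ ^ 2 / (δ / 2) ^ 2 < ε / 3) ∧ 0 < ρ := by
    refine (Eventually.and ?_ (self_mem_nhdsWithin : Set.Ioi (0 : ℝ) ∈ 𝓝[>] 0)).exists
    have hlim : Tendsto (fun ρ : ℝ => ρ ^ 2 / (δ / 2) ^ 2) (𝓝 0) (𝓝 (0 ^ 2 / (δ / 2) ^ 2)) :=
      Continuous.tendsto (by fun_prop) 0
    exact nhdsWithin_le_nhds ((eventually_lt_nhds (by positivity)).and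
      (hlim.eventually_lt_const (by simpa using hε0)))
  have hgood := hfF.inter (hf ρ hρ)
  -- One realisation of the estimator serves as a fixed element of `F` near `f₀`. Equicontinuity
  -- handles `f n ω` against `g`, and Chebyshev handles `g` against `f₀`.
  obtain ⟨m, ω₀, hgF, hgρ⟩ := hgood.exists_nonempty
  set g := f m ω₀
  change g ∈ F at hgF
  change eLpNorm (fun x => g x - f₀ x) 2 P < ENNReal.ofReal ρ at hgρ
  have hgm := hF.measurable g hgF
  have hum : Measurable fun x => g x - f₀ x := hgm.sub hf₀
  have hu2 : MemLp (fun x => g x - f₀ x) 2 P :=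
    ⟨hum.aestronglyMeasurable, hgρ.trans ENNReal.ofReal_lt_top⟩
  have hcheb : ∀ n, iidLaw P {ω | δ / 2 ≤ |empG P n ω (fun x => g x - f₀ x)|} ≤
      ENNReal.ofReal (ε / 3) := fun n => by
    rw [← ofReal_measureReal]
    refine ENNReal.ofReal_le_ofReal ?_
    refine (measureReal_le_abs_empG_le hum hu2 n (half_pos hδ)).trans (le_trans ?_ hρε.le)
    gcongr
    exact integral_sq_le_of_eLpNorm_lt hum.aestronglyMeasurable hgρ
  have hbad := Tendsto.eventually_le_const (u := ENNReal.ofReal (ε / 3)) (by simpa using hε0) hgood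
  filter_upwards [hequi, hbad] with n hn1 hn2
  have hsum : (ε : ℝ≥0∞) =
      ENNReal.ofReal (ε / 3) + ENNReal.ofReal (ε / 3) + ENNReal.ofReal (ε / 3) := by
    rw [← ENNReal.ofReal_add (by positivity) (by positivity),
      ← ENNReal.ofReal_add (by positivity) (by positivity), ← ENNReal.ofReal_coe_nnreal]
    congr 1
    ring
  refine le_trans ?_ hε.le
  rw [hsum]
  refine le_trans ?_ (add_le_add (add_le_add hn2 hn1) (hcheb n))
  refine le_trans (measure_mono ?_) ((measure_union_le _ _).trans
    (add_le_add (measure_union_le _ _) le_rfl))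
  intro ω hω
  by_contra hcon
  simp only [Set.mem_union, not_or, Set.mem_compl_iff, not_not] at hcon
  obtain ⟨⟨⟨hfF', hfρ⟩, hno⟩, hsmall⟩ := hcon
  simp only [Set.mem_ofPred_eq, not_le] at hfF' hfρ hno hsmall hω
  have hfm := hF.measurable _ hfF'
  refine hno ⟨f n ω, hfF', g, hgF, ?_, ?_⟩
  · have hadd := eLpNorm_sub_le (μ := P) (p := 2) (f := fun x => f n ω x - f₀ x)
      (g := fun x => g x - f₀ x) (hfm.sub hf₀).aestronglyMeasurable hum.aestronglyMeasurable
      (by norm_num)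
    have heq : (fun x => f n ω x - f₀ x) - (fun x => g x - f₀ x) = fun x => f n ω x - g x := by
      ext x
      simp
    rw [heq] at hadd
    refine hadd.trans_lt ((ENNReal.add_lt_add hfρ hgρ).trans_le ?_)
    rw [← ENNReal.ofReal_add hρ.le hρ.le]
    exact ENNReal.ofReal_le_ofReal (by linarith)
  · rw [empG_sub (hF.integrable g hgF) (hf₀2.integrable (by norm_num))] at hsmall
    by_contra hlt
    rw [not_le] at hlt
    refine hω.not_gt ?_
    rw [abs_lt] at *
    constructor <;> linarith [hsmall.1, hsmall.2, hlt.1, hlt.2]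

end Empirical

/-! ### Density identities and the one-step expansion -/

section Density

variable {X : Type*} [MeasurableSpace X] {lam P : Measure X} {η₀ : X → ℝ}

theorem IsDensityOf.integral_eq (h : IsDensityOf lam η₀ P) (g : X → ℝ) :
    ∫ x, g x ∂P = ∫ x, η₀ x * g x ∂lam := by
  rw [h.eq_withDensity, integral_withDensity_eq_integral_toReal_smul
    h.measurable.ennreal_ofReal (ae_of_all _ fun _ => ENNReal.ofReal_lt_top)]
  refine integral_congr_ae (h.nonneg.mono fun x hx => ?_)
  simp [ENNReal.toReal_ofReal hx]

theorem IsDensityOf.integral_self (h : IsDensityOf lam η₀ P) :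
    ∫ x, η₀ x ∂P = avgDensity lam η₀ := by
  rw [h.integral_eq, avgDensity]
  simp only [sq]

theorem IsDensityOf.integrable [IsProbabilityMeasure P] (h : IsDensityOf lam η₀ P) :
    Integrable η₀ lam := by
  refine ⟨h.measurable.aestronglyMeasurable, ?_⟩
  rw [hasFiniteIntegral_iff_ofReal h.nonneg]
  have h1 : P Set.univ = 1 := measure_univ
  rw [h.eq_withDensity, withDensity_apply _ MeasurableSet.univ, Measure.restrict_univ] at h1
  rw [h1]
  exact ENNReal.one_lt_top

theorem ae_abs_le_of_eLpNorm_top_lt {f : X → ℝ} {M : ℝ}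
    (h : eLpNorm f ∞ lam < ENNReal.ofReal M) : ∀ᵐ x ∂lam, |f x| ≤ M := by
  rw [eLpNorm_exponent_top] at h
  filter_upwards [ae_lt_of_essSup_lt h] with x hx
  rw [← ofReal_norm, Real.norm_eq_abs] at hx
  exact ((ENNReal.ofReal_lt_ofReal_iff_of_nonneg (abs_nonneg _)).1 hx).le

theorem IsDensityOf.memLp_two [IsProbabilityMeasure P] (h : IsDensityOf lam η₀ P) {M : ℝ}
    (hM : ∀ᵐ x ∂lam, |η₀ x| ≤ M) : MemLp η₀ 2 lam := by
  rw [memLp_two_iff_integrable_sq h.measurable.aestronglyMeasurable]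
  refine (h.integrable.const_mul M).mono' (h.measurable.pow_const 2).aestronglyMeasurable ?_
  filter_upwards [hM, h.nonneg] with x hx hx0
  rw [Real.norm_eq_abs, abs_pow, sq, abs_of_nonneg hx0] at *
  gcongr

theorem IsDensityOf.le_smul (h : IsDensityOf lam η₀ P) {M : ℝ}
    (hM : ∀ᵐ x ∂lam, |η₀ x| ≤ M) : P ≤ ENNReal.ofReal M • lam := by
  rw [h.eq_withDensity, ← withDensity_const]
  exact withDensity_mono (hM.mono fun x hx =>
    ENNReal.ofReal_le_ofReal ((le_abs_self _).trans hx))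

theorem IsDensityOf.eLpNorm_two_le (h : IsDensityOf lam η₀ P) {M : ℝ} (hM0 : 0 < M)
    (hM : ∀ᵐ x ∂lam, |η₀ x| ≤ M) (f : X → ℝ) :
    eLpNorm f 2 P ≤ ENNReal.ofReal (√M) * eLpNorm f 2 lam := by
  refine (eLpNorm_mono_measure f (h.le_smul hM)).trans ?_
  rw [eLpNorm_smul_measure_of_ne_top (by simp), smul_eq_mul, Real.sqrt_eq_rpow,
    ← ENNReal.ofReal_rpow_of_pos hM0]
  simp

theorem IsDensityOf.memLp_two_self [IsProbabilityMeasure P] (h : IsDensityOf lam η₀ P) {M : ℝ}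
    (hM : ∀ᵐ x ∂lam, |η₀ x| ≤ M) : MemLp η₀ 2 P :=
  (h.memLp_two hM).of_measure_le_smul (by simp) (h.le_smul hM)

/-- The von Mises expansion of the one-step estimator. -/
theorem IsDensityOf.sqrt_mul_oneStep_remainder [IsProbabilityMeasure P]
    (h : IsDensityOf lam η₀ P) (hη₀ : MemLp η₀ 2 lam) {n : ℕ} (hn : 0 < n) (ω : ℕ → X)
    (η : ∀ n : ℕ, (Fin n → X) → X → ℝ)
    (hη : MemLp (fun x => η n (sample n ω) x - η₀ x) 2 lam) :
    √(n : ℝ) * (oneStep lam η n (sample n ω) - avgDensity lam η₀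
        - empMean (sample n ω) (influence lam η₀)) =
      2 * (empG P n ω (η n (sample n ω)) - empG P n ω η₀)
        - √(n : ℝ) * ∫ x, (η n (sample n ω) x - η₀ x) ^ 2 ∂lam := by
  have hn' : (n : ℝ) ≠ 0 := by exact_mod_cast hn.ne'
  set e := η n (sample n ω) with he
  have he2 : MemLp e 2 lam := by
    have h2 := hη.add hη₀
    have heq : (fun x => e x - η₀ x) + η₀ = e := by
      ext x
      simp
    rwa [heq] at h2
  -- Needs `n ≠ 0`: the empirical mean of a constant over an empty sample is `0`.
  have hinfl : empMean (sample n ω) (influence lam η₀) =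
      2 * (empMean (sample n ω) η₀ - avgDensity lam η₀) := by
    simp only [empMean, influence, ← Finset.mul_sum, Finset.sum_sub_distrib, Finset.sum_const,
      Finset.card_univ, Fintype.card_fin, nsmul_eq_mul]
    field_simp
  have hexp : ∫ x, (e x - η₀ x) ^ 2 ∂lam =
      avgDensity lam e - 2 * ∫ x, e x ∂P + avgDensity lam η₀ := by
    have hprod : Integrable (fun x => η₀ x * e x) lam := hη₀.integrable_mul he2
    rw [h.integral_eq, avgDensity, avgDensity, ← integral_const_mul,
      ← integral_sub he2.integrable_sq (hprod.const_mul 2),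
      ← integral_add (f := fun x => e x ^ 2 - 2 * (η₀ x * e x))
        (he2.integrable_sq.sub (hprod.const_mul 2)) hη₀.integrable_sq]
    congr 1
    ext x
    ring
  rw [hexp, hinfl, oneStep, ← he, empG, empG, h.integral_self]
  ring

variable [IsProbabilityMeasure P]

theorem IsDensityOf.memLp_influence (h : IsDensityOf lam η₀ P) {M : ℝ}
    (hM : ∀ᵐ x ∂lam, |η₀ x| ≤ M) : MemLp (influence lam η₀) 2 P :=
  ((h.memLp_two_self hM).sub (memLp_const _)).const_mul 2

theorem IsDensityOf.integral_influence (h : IsDensityOf lam η₀ P) {M : ℝ}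
    (hM : ∀ᵐ x ∂lam, |η₀ x| ≤ M) : ∫ x, influence lam η₀ x ∂P = 0 := by
  have hi : Integrable η₀ P := (h.memLp_two_self hM).integrable (by norm_num)
  simp only [influence]
  rw [integral_const_mul, integral_sub hi (integrable_const _), h.integral_self]
  simp

theorem isAsymptoticallyLinear_oneStep (h : IsDensityOf lam η₀ P)
    {η : ∀ n : ℕ, (Fin n → X) → X → ℝ} {F : Set (X → ℝ)} (hF : IsDonsker P F)
    (hηF : WithProbTendingToOne (iidLaw P) (fun n => {ω | η n (sample n ω) ∈ F}))
    {M : ℝ} (hM0 : 0 < M) (hM : ∀ᵐ x ∂lam, |η₀ x| ≤ M)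
    (hrate : IsLittleOP (iidLaw P) (1 / 4)
      (fun n ω => eLpNorm (fun x => η n (sample n ω) x - η₀ x) 2 lam)) :
    IsAsymptoticallyLinear P (oneStep lam η) (avgDensity lam η₀) (influence lam η₀) := by
  refine ⟨h.memLp_influence hM, h.integral_influence hM, fun ε hε => ?_⟩
  have hcons : ∀ τ : ℝ, 0 < τ → WithProbTendingToOne (iidLaw P)
      fun n => {ω | eLpNorm (fun x => η n (sample n ω) x - η₀ x) 2 P < ENNReal.ofReal τ} := by
    intro τ hτ
    refine tendsto_measure_zero_of_eventually_subset_union (hrate (τ / √M) (by positivity))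
      (B := fun _ => ∅) (by simp) ?_
    filter_upwards [eventually_ge_atTop 1] with n hn ω hω
    refine Or.inl ?_
    by_contra hcon
    simp only [Set.mem_ofPred_eq, not_le, Set.mem_compl_iff, not_lt] at hcon hω
    have hpow : (n : ℝ) ^ (-(1 / 4) : ℝ) ≤ 1 :=
      Real.rpow_le_one_of_one_le_of_nonpos (by exact_mod_cast hn) (by norm_num)
    have hlt : eLpNorm (fun x => η n (sample n ω) x - η₀ x) 2 lam < ENNReal.ofReal (τ / √M) :=
      hcon.trans_le (ENNReal.ofReal_le_ofReal (mul_le_of_le_one_right (by positivity) hpow))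
    refine hω.not_gt ((h.eLpNorm_two_le hM0 hM _).trans_lt ?_)
    have hτM : ENNReal.ofReal τ = ENNReal.ofReal √M * ENNReal.ofReal (τ / √M) := by
      rw [← ENNReal.ofReal_mul (by positivity)]
      congr 1
      field_simp
    rw [hτM]
    exact ENNReal.mul_lt_mul_right (by simpa using hM0) ENNReal.ofReal_ne_top hlt
  have hemp := hF.tendsto_measure_le_abs_empG_sub h.measurable (h.memLp_two_self hM) hηF hcons
    (δ := ε / 4) (by positivity)
  -- Squaring `√(ε / 2) n^(-1/4)` bounds the quadratic term by `ε / 2` after scaling by `√n`; the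
  -- empirical term, doubled from `ε / 4`, stays strictly below the other `ε / 2`.
  have hbad := tendsto_measure_zero_of_eventually_subset_union (S := fun n =>
      {ω | η n (sample n ω) ∈ F}ᶜ ∪ {ω | ENNReal.ofReal (√(ε / 2) * (n : ℝ) ^ (-(1 / 4) : ℝ)) ≤
        eLpNorm (fun x => η n (sample n ω) x - η₀ x) 2 lam}) hηF
    (hrate (√(ε / 2)) (by positivity)) (Eventually.of_forall fun _ => subset_rfl)
  refine tendsto_measure_zero_of_eventually_subset_union hbad hemp ?_
  filter_upwards [eventually_gt_atTop 0] with n hn ω hω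
  by_contra hcon
  simp only [Set.mem_union, not_or, Set.mem_compl_iff, not_not, Set.mem_ofPred_eq, not_le] at hcon
  obtain ⟨⟨hmem, hnorm⟩, hG⟩ := hcon
  have hn' : (0 : ℝ) < n := by exact_mod_cast hn
  -- Measurability of the estimate is available only on the event that it lies in `F`.
  have hmeas : Measurable fun x => η n (sample n ω) x - η₀ x :=
    (hF.measurable _ hmem).sub h.measurable
  have hexp := h.sqrt_mul_oneStep_remainder (h.memLp_two hM) hn ω η
    ⟨hmeas.aestronglyMeasurable, hnorm.trans ENNReal.ofReal_lt_top⟩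
  have hint := integral_sq_le_of_eLpNorm_lt hmeas.aestronglyMeasurable hnorm
  have hint0 : 0 ≤ ∫ x, (η n (sample n ω) x - η₀ x) ^ 2 ∂lam :=
    integral_nonneg fun x => sq_nonneg _
  have hsn : 0 < √(n : ℝ) := Real.sqrt_pos.2 hn'
  have hhalf : (n : ℝ) ^ (-(1 / 2) : ℝ) = (√(n : ℝ))⁻¹ := by
    rw [Real.rpow_neg hn'.le, Real.sqrt_eq_rpow]
  have hquart : ((n : ℝ) ^ (-(1 / 4) : ℝ)) ^ 2 = (√(n : ℝ))⁻¹ := by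
    rw [← hhalf, ← Real.rpow_natCast, ← Real.rpow_mul hn'.le]
    norm_num
  rw [mul_pow, Real.sq_sqrt (by positivity), hquart] at hint
  have hint' : √(n : ℝ) * ∫ x, (η n (sample n ω) x - η₀ x) ^ 2 ∂lam ≤ ε / 2 := by
    calc _ ≤ √(n : ℝ) * (ε / 2 * (√(n : ℝ))⁻¹) := by gcongr
      _ = ε / 2 := by field_simp
  have hint0' : 0 ≤ √(n : ℝ) * ∫ x, (η n (sample n ω) x - η₀ x) ^ 2 ∂lam := by positivity
  simp only [Set.mem_ofPred_eq] at hω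
  rw [← ofReal_norm, ENNReal.ofReal_le_ofReal_iff (norm_nonneg _), hhalf,
    Real.norm_eq_abs, ← div_eq_mul_inv, div_le_iff₀ hsn, mul_comm] at hω
  nth_rw 1 [← abs_of_pos hsn] at hω
  rw [← abs_mul, hexp] at hω
  refine hω.not_gt ?_
  rw [abs_lt] at *
  constructor <;> linarith [hG.1, hG.2]

theorem IsAsymptoticallyLinear.of_sub {T T' : ∀ n : ℕ, (Fin n → X) → ℝ} {ψ : ℝ} {φ : X → ℝ}
    (hT : IsAsymptoticallyLinear P T ψ φ) {D : ℕ → (ℕ → X) → ℝ}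
    (hD : IsLittleOP (iidLaw P) (1 / 2) fun n ω => ‖D n ω‖ₑ) {c : ℝ} (hc : 0 < c)
    (h : ∀ n ω, T' n (sample n ω) = T n (sample n ω) + c * D n ω) :
    IsAsymptoticallyLinear P T' ψ φ := by
  refine ⟨hT.memLp, hT.mean_zero, (hT.remainder.add (hD.const_mul hc)).mono fun n ω => ?_⟩
  have heq : T' n (sample n ω) - ψ - empMean (sample n ω) φ =
      (T n (sample n ω) - ψ - empMean (sample n ω) φ) + c * D n ω := by
    rw [h]
    ring
  rw [heq]
  refine (enorm_add_le _ _).trans_eq ?_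
  rw [enorm_mul, Real.enorm_eq_ofReal hc.le]

end Density

end AvgDensity

/-! ### Conclusion for the three estimators -/

theorem proposition3 {d : ℕ} (S : Set (EuclideanSpace ℝ (Fin d))) (hS : MeasurableSet S)
    (P₀ : Measure S) [IsProbabilityMeasure P₀]
    (η₀ : S → ℝ) (hη₀ : AvgDensity.IsDensityOf (AvgDensity.lebesgueOn S) η₀ P₀)
    (η : ∀ n : ℕ, (Fin n → S) → S → ℝ)
    (F : Set (S → ℝ)) (hF : AvgDensity.IsDonsker P₀ F)
    (hηF : AvgDensity.WithProbTendingToOne (AvgDensity.iidLaw P₀)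
      (fun n => {ω | η n (AvgDensity.sample n ω) ∈ F}))
    (M : ℝ) (hM : 0 < M)
    (hη₀M : eLpNorm η₀ ∞ (AvgDensity.lebesgueOn S) < ENNReal.ofReal M)
    (hηM : AvgDensity.WithProbTendingToOne (AvgDensity.iidLaw P₀)
      (fun n => {ω | eLpNorm (η n (AvgDensity.sample n ω)) ∞ (AvgDensity.lebesgueOn S)
        < ENNReal.ofReal M}))
    (hrate : AvgDensity.IsLittleOP (AvgDensity.iidLaw P₀) (1 / 4)
      (fun n ω => eLpNorm (fun x => η n (AvgDensity.sample n ω) x - η₀ x) 2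
        (AvgDensity.lebesgueOn S))) :
    AvgDensity.IsAsymptoticallyLinear P₀ (AvgDensity.oneStep (AvgDensity.lebesgueOn S) η)
        (AvgDensity.avgDensity (AvgDensity.lebesgueOn S) η₀) (AvgDensity.influence (AvgDensity.lebesgueOn S) η₀) ∧
      (AvgDensity.IsLittleOP (AvgDensity.iidLaw P₀) (1 / 2)
          (fun n ω => ‖AvgDensity.avgDensity (AvgDensity.lebesgueOn S) (η n (AvgDensity.sample n ω))
            - AvgDensity.empMean (AvgDensity.sample n ω) (η n (AvgDensity.sample n ω))‖ₑ) →
        AvgDensity.IsAsymptoticallyLinear P₀ (AvgDensity.plugIn (AvgDensity.lebesgueOn S) η)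
            (AvgDensity.avgDensity (AvgDensity.lebesgueOn S) η₀) (AvgDensity.influence (AvgDensity.lebesgueOn S) η₀) ∧
          AvgDensity.IsAsymptoticallyLinear P₀ (AvgDensity.meanPlugIn η)
            (AvgDensity.avgDensity (AvgDensity.lebesgueOn S) η₀) (AvgDensity.influence (AvgDensity.lebesgueOn S) η₀)) := by
  have hlin := AvgDensity.isAsymptoticallyLinear_oneStep hη₀ hF hηF hM
    (AvgDensity.ae_abs_le_of_eLpNorm_top_lt hη₀M) hrate
  refine ⟨hlin, fun hD => ⟨hlin.of_sub hD two_pos fun n ω => ?_, hlin.of_sub hD one_pos fun n ω => ?_⟩⟩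
  · simp only [AvgDensity.plugIn, AvgDensity.oneStep]
    ring
  · simp only [AvgDensity.meanPlugIn, AvgDensity.oneStep]
    ring
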